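/- Let $d \in \mathbb{N}$, let $\|\cdot\|_d$ be an arbitrary norm on $\mathbb{R}^d$, and let $\langle\cdot,\cdot\rangle$ denote the Euclidean inner product on $\mathbb{R}^d$. Let $F : (\mathbb{R}^d, \|\cdot\|_d) \to (\mathbb{R}^d, \|\cdot\|_d)$ be a continuous function, and suppose that for some $\varrho > 0$ one has $\langle F(\xi), \xi\rangle \geq 0$ for every $\xi \in \mathbb{R}^d$ with $\|\xi\|_d = \varrho$. Then there exists $z_0 \in \mathbb{R}^d$ with $\|z_0\|_d \leq \varrho$ and $F(z_0) = 0$. -/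

import Mathlib

/-- A seminorm on a real vector space is a norm if it vanishes only at the origin. -/
def Seminorm.IsNorm {E : Type*} [AddCommGroup E] [Module ℝ E] (p : Seminorm ℝ E) : Prop :=
  ∀ x : E, p x = 0 → x = 0

/-- Continuity of `F : (E, p) → (E, p)`, i.e. with respect to the metric `p (y - x)` on both
sides. -/
def Seminorm.ContinuousSelfMap {E : Type*} [AddCommGroup E] [Module ℝ E] (p : Seminorm ℝ E)
    (F : E → E) : Prop :=
  ∀ x : E, ∀ ε : ℝ, 0 < ε → ∃ δ : ℝ, 0 < δ ∧ ∀ y : E, p (y - x) < δ → p (F y - F x) < ε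

open MeasureTheory Metric Set Module
open scoped NNReal Topology

/-! Keep `F` on the `p`-ball of radius `ϱ` and deform it outside, along rays, to the identity. The
sign condition prevents new zeros: outside the ball the deformed field has positive inner product
with `x`. So it suffices that a continuous field equal to the identity far out has a zero
(`exists_add_eq_zero_of_support_subset_ball`).

Otherwise, smoothing and normalising it would give a C¹ retraction `r` of a Euclidean ball onto its
sphere. This is excluded by volume: the Jacobian of `x + t (r x - x)` integrates to a polynomial in
`t`, which is the constant `vol` for small `t` (`exists_integral_det_id_add_smul_eq`), yet vanishes
at `t = 1`, where `D r` is singular. -/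

/-- `t ↦ det (1 + t A)` is a polynomial of degree at most `dim V`, so its value at `1` is given by
Lagrange interpolation from more than `dim V` nodes. -/
theorem LinearMap.det_one_add_eq_sum_lagrange {V ι : Type*} [AddCommGroup V] [Module ℝ V]
    [FiniteDimensional ℝ V] [DecidableEq ι] (A : V →ₗ[ℝ] V) {s : Finset ι} {v : ι → ℝ}
    (hv : Set.InjOn v s) (hs : finrank ℝ V < s.card) :
    LinearMap.det (1 + A) =
      ∑ i ∈ s, (Lagrange.basis s v i).eval 1 * LinearMap.det (1 + v i • A) := by
  let b := finBasis ℝ V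
  let M := LinearMap.toMatrix b b A
  let P : Polynomial ℝ := Matrix.det
    ((Polynomial.X : Polynomial ℝ) • M.map Polynomial.C + (1 : Matrix _ _ ℝ).map Polynomial.C)
  have hP (t : ℝ) : P.eval t = LinearMap.det (1 + t • A) := by
    rw [← LinearMap.det_toMatrix b, ← Polynomial.coe_evalRingHom, RingHom.map_det]
    congr 1
    ext i j
    rcases eq_or_ne i j with rfl | hij
    · simp [M, LinearMap.toMatrix_one, add_comm, mul_comm t]
    · simp [M, LinearMap.toMatrix_one, hij, mul_comm t]
  have hdeg : P.degree < s.card := by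
    refine Polynomial.degree_le_natDegree.trans_lt (Nat.cast_lt.mpr (lt_of_le_of_lt ?_ hs))
    exact (Polynomial.natDegree_det_X_add_C_le M 1).trans_eq (Fintype.card_fin _)
  have h := congrArg (Polynomial.eval 1) (Lagrange.eq_interpolate hv hdeg)
  rw [hP, one_smul, Lagrange.interpolate_apply, Polynomial.eval_finsetSum] at h
  rw [h]
  refine Finset.sum_congr rfl fun i _ => ?_
  rw [Polynomial.eval_mul, Polynomial.eval_C, hP, mul_comm]

/-- A map that is Lipschitz on a closed ball and vanishes on its boundary sphere stays Lipschitz with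
the same constant when extended by zero. -/
theorem LipschitzOnWith.lipschitzWith_indicator_closedBall {E F : Type*} [NormedAddCommGroup E]
    [NormedSpace ℝ E] [NormedAddCommGroup F] {k : E → F} {L : ℝ≥0} {R : ℝ}
    (hk : LipschitzOnWith L k (closedBall 0 R)) (h0 : ∀ x, ‖x‖ = R → k x = 0) :
    LipschitzWith L ((closedBall 0 R).indicator k) := by
  have key : ∀ x ∈ closedBall (0 : E) R, ∀ y ∉ closedBall (0 : E) R,
      dist (k x) 0 ≤ L * dist x y := by
    intro x hx y hy
    rw [mem_closedBall_zero_iff] at hx hy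
    -- The segment from `x` to `y` crosses the sphere, where `k` vanishes.
    obtain ⟨t, ht, hz⟩ : R ∈ (fun t : ℝ => ‖AffineMap.lineMap x y t‖) '' Icc 0 1 :=
      intermediate_value_Icc zero_le_one
        (by fun_prop) ⟨by simpa using hx, by simpa using (not_le.mp hy).le⟩
    have hz' : ‖AffineMap.lineMap x y t‖ = R := hz
    calc dist (k x) 0 = dist (k x) (k (AffineMap.lineMap x y t)) := by rw [h0 _ hz']
      _ ≤ L * dist x (AffineMap.lineMap x y t) :=
        hk.dist_le_mul _ (by simpa using hx) _ (by simp [hz'])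
      _ ≤ L * dist x y := by
        gcongr
        rw [dist_left_lineMap, Real.norm_of_nonneg ht.1]
        exact mul_le_of_le_one_left dist_nonneg ht.2
  refine LipschitzWith.of_dist_le_mul fun x y => ?_
  by_cases hx : x ∈ closedBall (0 : E) R <;> by_cases hy : y ∈ closedBall (0 : E) R
  · simpa [indicator_of_mem hx, indicator_of_mem hy] using hk.dist_le_mul _ hx _ hy
  · rw [indicator_of_mem hx, indicator_of_notMem hy]
    exact key x hx y hy
  · rw [indicator_of_notMem hx, indicator_of_mem hy, dist_comm, dist_comm x]
    exact key y hy x hx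
  · rw [indicator_of_notMem hx, indicator_of_notMem hy, dist_self]
    positivity

/-! ### Perturbations of the identity and volume -/

variable {E : Type*} [NormedAddCommGroup E] [InnerProductSpace ℝ E] [FiniteDimensional ℝ E]

/-- The perturbation `t • k` is a strict contraction, so the quantitative inverse function theorem
applies globally. -/
theorem LipschitzWith.bijective_id_add_smul {k : E → E} {L : ℝ≥0} (hk : LipschitzWith L k)
    {t : ℝ} (ht : |t| * L < 1) : Function.Bijective fun x => x + t • k x := by
  have happ : ApproximatesLinearOn (fun x => x + t • k x)
      (ContinuousLinearEquiv.refl ℝ E : E →L[ℝ] E) univ (‖t‖₊ * L) := by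
    rw [ApproximatesLinearOn.approximatesLinearOn_iff_lipschitzOnWith]
    have : (fun x => x + t • k x) - ⇑(ContinuousLinearEquiv.refl ℝ E : E →L[ℝ] E)
        = fun x => t • k x := by ext x; simp
    rw [this, lipschitzOnWith_univ]
    exact (lipschitzWith_smul t).comp hk
  have hc : Subsingleton E ∨ ‖t‖₊ * L <
      ‖((ContinuousLinearEquiv.refl ℝ E).symm : E →L[ℝ] E)‖₊⁻¹ := by
    rcases subsingleton_or_nontrivial E with h | h
    · exact .inl h
    · refine .inr ?_
      have : ‖((ContinuousLinearEquiv.refl ℝ E).symm : E →L[ℝ] E)‖₊ = 1 :=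
        NNReal.eq ContinuousLinearMap.norm_id
      rw [this, inv_one, ← NNReal.coe_lt_coe]
      simpa using ht
  exact (happ.toHomeomorph _ hc).bijective

/-- A small Lipschitz perturbation of the identity that is trivial on the sphere permutes the ball. -/
theorem image_ball_id_add_smul {k : E → E} {L : ℝ≥0} {R t : ℝ}
    (hk : LipschitzOnWith L k (closedBall 0 R)) (h0 : ∀ x, ‖x‖ = R → k x = 0)
    (ht : |t| * L < 1) :
    InjOn (fun x => x + t • k x) (ball 0 R) ∧
      (fun x => x + t • k x) '' ball 0 R = ball 0 R := by
  set K := (closedBall (0 : E) R).indicator k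
  have hbij := (hk.lipschitzWith_indicator_closedBall h0).bijective_id_add_smul ht
  have heq : EqOn (fun x => x + t • K x) (fun x => x + t • k x) (ball 0 R) := fun x hx => by
    simp [K, indicator_of_mem (ball_subset_closedBall hx)]
  have hout : ∀ x ∉ ball (0 : E) R, x + t • K x = x := by
    intro x hx
    rw [mem_ball_zero_iff, not_lt] at hx
    rcases hx.eq_or_lt with h | h
    · simp [K, indicator, h0 x h.symm]
    · simp [K, h]
  refine ⟨heq.injOn_iff.mp hbij.injective.injOn, ?_⟩
  rw [← heq.image_eq]
  -- The global bijection fixes every point outside the ball, hence preserves the ball too.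
  have hc : (fun x => x + t • K x) '' (ball 0 R)ᶜ = (ball 0 R)ᶜ := by
    exact (EqOn.image_eq (f₂ := id) hout).trans (image_id _)
  rw [← compl_inj_iff, ← image_compl_eq hbij, hc]

/-- For small `t` the map `x ↦ x + t k x` permutes the ball, so its Jacobian integrates to the volume. -/
theorem exists_integral_det_id_add_smul_eq [MeasurableSpace E] [BorelSpace E] {k : E → E}
    (hk : ContDiff ℝ 1 k) {R : ℝ} (h0 : ∀ x, ‖x‖ = R → k x = 0) :
    ∃ δ > 0, ∀ t : ℝ, |t| < δ →
      ∫ x in ball (0 : E) R, (1 + t • fderiv ℝ k x).det = volume.real (ball (0 : E) R) := by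
  obtain ⟨M, hM⟩ := (isCompact_closedBall (0 : E) R).exists_bound_of_continuousOn
    (hk.continuous_fderiv one_ne_zero).continuousOn
  have hL : LipschitzOnWith M.toNNReal k (closedBall 0 R) :=
    (convex_closedBall (0 : E) R).lipschitzOnWith_of_nnnorm_fderiv_le
      (fun x _ => hk.differentiable one_ne_zero x)
      fun x hx => by
        rw [← NNReal.coe_le_coe, coe_nnnorm]
        exact (hM x hx).trans (Real.le_coe_toNNReal M)
  -- Positivity removes the absolute value from the change of variables formula.
  obtain ⟨ε, hε, hdet⟩ : ∃ ε > 0, ∀ B : E →L[ℝ] E, ‖B‖ < ε → 0 < (1 + B).det := by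
    have hc : Continuous fun B : E →L[ℝ] E => (1 + B).det :=
      ContinuousLinearMap.continuous_det.comp (by fun_prop)
    have : ∀ᶠ B in 𝓝 (0 : E →L[ℝ] E), 0 < (1 + B).det :=
      hc.continuousAt.eventually_const_lt (by simp [ContinuousLinearMap.det])
    obtain ⟨ε, hε, h⟩ := Metric.eventually_nhds_iff.mp this
    exact ⟨ε, hε, fun B hB => h (by simpa using hB)⟩
  set N : ℝ := max M 0 + 1
  have hN : 0 < N := by positivity
  refine ⟨min ε 1 / N, by positivity, fun t ht => ?_⟩
  rw [lt_div_iff₀ hN] at ht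
  have htL : |t| * (M.toNNReal : ℝ) < 1 := by
    refine lt_of_le_of_lt ?_ (ht.trans_le (min_le_right _ _))
    gcongr
    simp [N, Real.coe_toNNReal']
  obtain ⟨hinj, himg⟩ := image_ball_id_add_smul hL h0 htL
  have hd : ∀ x ∈ ball (0 : E) R, HasFDerivWithinAt (fun x => x + t • k x)
      (1 + t • fderiv ℝ k x) (ball 0 R) x := fun x _ =>
    ((hasFDerivAt_id x).add
      ((hk.differentiable one_ne_zero x).hasFDerivAt.const_smul t)).hasFDerivWithinAt
  have hcv := integral_image_eq_integral_abs_det_fderiv_smul volume measurableSet_ball hd hinj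
    fun _ => (1 : ℝ)
  rw [himg] at hcv
  simp only [smul_eq_mul, mul_one, integral_const, measureReal_restrict_apply_univ] at hcv
  rw [hcv]
  refine setIntegral_congr_fun measurableSet_ball fun x hx => (abs_of_pos (hdet _ ?_)).symm
  rw [norm_smul, Real.norm_eq_abs]
  refine lt_of_le_of_lt ?_ (ht.trans_le (min_le_left _ _))
  gcongr
  exact (hM x (ball_subset_closedBall hx)).trans
    ((le_max_left M 0).trans (le_add_of_nonneg_right zero_le_one))

/-! ### No retraction onto the sphere -/

/-- A map with values in a sphere has singular derivative. -/
theorem det_fderiv_eq_zero_of_norm_eq {r : E → E} {R : ℝ} (hR : 0 < R) {x : E}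
    (hr : DifferentiableAt ℝ r x) (hn : ∀ y, ‖r y‖ = R) : (fderiv ℝ r x).det = 0 := by
  by_contra hdet
  have horth (v : E) : inner ℝ (r x) (fderiv ℝ r x v) = 0 := by
    have h1 := hr.hasFDerivAt.norm_sq
    have h2 : HasFDerivAt (fun y => ‖r y‖ ^ 2) (0 : E →L[ℝ] ℝ) x := by
      simp only [hn]; exact hasFDerivAt_const _ _
    have := congrArg (· v) (h1.unique h2)
    simpa using this
  -- An invertible derivative would have `r x` in its range, making `r x` orthogonal to itself.
  obtain ⟨v, hv⟩ := (LinearMap.equivOfDetNeZero (fderiv ℝ r x : E →ₗ[ℝ] E) hdet).surjective (r x)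
  have hv' : fderiv ℝ r x v = r x := hv
  have := horth v
  rw [hv', inner_self_eq_zero, ← norm_eq_zero, hn] at this
  exact hR.ne' this

/-- There is no `C¹` retraction onto a sphere: the integral over the ball of the Jacobian of
`x ↦ x + t (r x - x)` is polynomial in `t`, equal to the volume for small `t`, and zero at `t = 1`. -/
theorem not_exists_contDiff_retraction_sphere {R : ℝ} (hR : 0 < R) {r : E → E}
    (hr : ContDiff ℝ 1 r) (hn : ∀ x, ‖r x‖ = R) : ¬ ∀ x, ‖x‖ = R → r x = x := by
  intro hfix
  borelize E
  have hk : ContDiff ℝ 1 fun x => r x - x := hr.sub contDiff_id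
  obtain ⟨δ, hδ, hint⟩ := exists_integral_det_id_add_smul_eq hk
    (fun x hx => sub_eq_zero.mpr (hfix x hx))
  set k : E → E := fun x => r x - x
  set s := Finset.range (finrank ℝ E + 1)
  -- Distinct nodes; the shift by 2 keeps even `v 0` strictly below `δ`.
  let v : ℕ → ℝ := fun i => δ / (i + 2)
  have hv : Function.Injective v := by
    intro i j hij
    have h2 : ((i : ℝ) + 2) = j + 2 := by
      have := congrArg (δ / ·) hij
      simpa [v, div_div_cancel₀ hδ.ne'] using this
    exact_mod_cast add_right_cancel h2
  have hvδ (i : ℕ) : |v i| < δ := by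
    have hi : (0 : ℝ) < i + 2 := by positivity
    rw [abs_of_pos (by positivity), div_lt_iff₀ hi]
    nlinarith
  have hdet (x : E) : 0 = ∑ i ∈ s, (Lagrange.basis s v i).eval 1 *
      (1 + v i • fderiv ℝ k x).det := by
    have h1 : fderiv ℝ r x = 1 + fderiv ℝ k x := by
      have : fderiv ℝ k x = fderiv ℝ r x - fderiv ℝ id x :=
        fderiv_sub (hr.differentiable one_ne_zero x) differentiableAt_id
      rw [this, fderiv_id]
      exact (add_sub_cancel _ _).symm
    rw [← det_fderiv_eq_zero_of_norm_eq hR (hr.differentiable one_ne_zero x) hn, h1]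
    exact LinearMap.det_one_add_eq_sum_lagrange (fderiv ℝ k x : E →ₗ[ℝ] E) hv.injOn (by simp [s])
  have hi (i : ℕ) : IntegrableOn (fun x => (1 + v i • fderiv ℝ k x).det) (ball 0 R) := by
    have hk' := hk.continuous_fderiv one_ne_zero
    have hc : Continuous fun x => (1 + v i • fderiv ℝ k x).det :=
      ContinuousLinearMap.continuous_det.comp
        (by fun_prop)
    exact (hc.continuousOn.integrableOn_compact (isCompact_closedBall 0 R)).mono_set
      ball_subset_closedBall
  -- Interpolation reproduces constants, so equal volumes at all nodes give the volume at `t = 1`.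
  have hsum : ∑ i ∈ s, (Lagrange.basis s v i).eval 1 = 1 := by
    rw [← Polynomial.eval_finsetSum, Lagrange.sum_basis hv.injOn (by simp [s]),
      Polynomial.eval_one]
  have hzero : (0 : ℝ) = volume.real (ball (0 : E) R) := by
    calc (0 : ℝ) = ∫ x in ball (0 : E) R, ∑ i ∈ s, (Lagrange.basis s v i).eval 1 *
          (1 + v i • fderiv ℝ k x).det := by simp [← hdet]
      _ = ∑ i ∈ s, (Lagrange.basis s v i).eval 1 * volume.real (ball (0 : E) R) := by
        rw [integral_finsetSum _ fun i _ => (hi i).const_mul _]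
        refine Finset.sum_congr rfl fun i _ => ?_
        rw [integral_const_mul, hint _ (hvδ i)]
      _ = volume.real (ball (0 : E) R) := by rw [← Finset.sum_mul, hsum, one_mul]
  exact (ENNReal.toReal_pos (measure_ball_pos volume 0 hR).ne' measure_ball_lt_top.ne).ne hzero

/-! ### Existence of zeros -/

/-- A continuous self-map equal to the identity outside a ball has a zero. -/
theorem exists_add_eq_zero_of_support_subset_ball {K : E → E} (hK : Continuous K) {R : ℝ}
    (hR : 0 < R) (hsupp : ∀ x, R ≤ ‖x‖ → K x = 0) : ∃ x, x + K x = 0 := by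
  by_contra! hne
  -- An error below `‖x + K x‖` creates no zero, and the support of `g` stays inside that of `K`.
  obtain ⟨g, hg, hdist, hgsupp⟩ := hK.exists_contDiff_approx (ε := fun x => ‖x + K x‖) 1
    (by fun_prop) fun x => norm_pos_iff.mpr (hne x)
  have hH0 (x : E) : x + g x ≠ 0 := by
    intro h
    have := hdist x
    rw [eq_neg_of_add_eq_zero_right h, dist_eq_norm, ← neg_add', norm_neg] at this
    exact this.false
  have hH : ContDiff ℝ 1 fun x => x + g x := contDiff_id.add hg
  refine not_exists_contDiff_retraction_sphere hR
    (r := fun x => (R * ‖x + g x‖⁻¹) • (x + g x)) ?_ ?_ ?_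
  · exact (contDiff_const.mul ((hH.norm ℝ hH0).inv fun x => norm_ne_zero_iff.mpr (hH0 x))).smul hH
  · intro x
    rw [norm_smul, norm_mul, norm_inv, norm_norm, Real.norm_of_nonneg hR.le,
      inv_mul_cancel_right₀ (norm_ne_zero_iff.mpr (hH0 x))]
  · intro x hx
    have hgx : g x = 0 := by
      by_contra h
      exact hgsupp h (hsupp x hx.ge)
    simp [hgx, hx, hR.ne']

/-- A continuous map pointing weakly outwards on the sphere of a norm has a zero in the closed ball. -/
theorem exists_zero_of_inner_nonneg {p : Seminorm ℝ E} (hpc : Continuous p) {C : ℝ}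
    (hC0 : 0 < C) (hC : ∀ x, ‖x‖ ≤ C * p x) {F : E → E} (hF : Continuous F) {ϱ : ℝ} (hϱ : 0 < ϱ)
    (h : ∀ ξ, p ξ = ϱ → 0 ≤ inner ℝ (F ξ) ξ) : ∃ z, p z ≤ ϱ ∧ F z = 0 := by
  -- `m x • x` is the radial retraction onto the `p`-ball; the cutoff `φ` is 1 there and 0 once `p x
  -- ≥ 2ϱ`.
  let m : E → ℝ := fun x => ϱ / max ϱ (p x)
  let φ : E → ℝ := fun x => max 0 (min 1 (2 - p x / ϱ))
  have hmax (x : E) : max ϱ (p x) ≠ 0 := (lt_max_of_lt_left hϱ).ne'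
  have hmc : Continuous m := by
    exact continuous_const.div (by fun_prop) hmax
  have hφc : Continuous φ := by fun_prop
  obtain ⟨x, hx⟩ := exists_add_eq_zero_of_support_subset_ball
    (K := fun x => φ x • (F (m x • x) - x)) (by fun_prop) (R := max 1 (C * (2 * ϱ)))
    (by positivity) fun x hx => by
      have hφ : φ x = 0 := by
        have h2 : 2 * ϱ ≤ p x := le_of_mul_le_mul_left
          ((le_max_right _ _).trans (hx.trans (hC x))) hC0
        have h3 : 2 ≤ p x / ϱ := (le_div_iff₀ hϱ).mpr h2
        exact max_eq_left ((min_le_right _ _).trans (by linarith))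
      simp [hφ]
  refine ⟨x, ?_⟩
  rcases le_or_gt (p x) ϱ with hpx | hpx
  · have hm : m x = 1 := by simp [m, hpx, hϱ.ne']
    have hφ : φ x = 1 := by
      have : p x / ϱ ≤ 1 := (div_le_one hϱ).mpr hpx
      simp only [φ]
      rw [min_eq_left (by linarith), max_eq_right zero_le_one]
    refine ⟨hpx, ?_⟩
    simpa [hm, hφ] using hx
  · exfalso
    have hm : m x = ϱ / p x := by simp [m, hpx.le]
    have hp0 : 0 < p x := hϱ.trans hpx
    have hm0 : 0 < m x := by rw [hm]; positivity
    have hφ0 : 0 ≤ φ x := le_max_left _ _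
    have hφ1 : φ x < 1 := by
      have : 1 < p x / ϱ := (one_lt_div hϱ).mpr hpx
      exact max_lt one_pos ((min_le_right _ _).trans_lt (by linarith))
    have hin : 0 ≤ inner ℝ (F (m x • x)) x := by
      have hpm : p (m x • x) = ϱ := by
        rw [map_smul_eq_mul, Real.norm_of_nonneg hm0.le, hm, div_mul_cancel₀ _ hp0.ne']
      have := h _ hpm
      rw [inner_smul_right] at this
      exact nonneg_of_mul_nonneg_right this hm0
    have hx0 : 0 < ‖x‖ := norm_pos_iff.mpr fun h0 => by simp [h0] at hp0
    have h2 : inner ℝ (x + φ x • (F (m x • x) - x)) x = 0 := by rw [hx, inner_zero_left]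
    rw [inner_add_left, inner_smul_left, inner_sub_left, real_inner_self_eq_norm_sq] at h2
    simp only [conj_trivial] at h2
    -- `h2` reads `(1 - φ x)‖x‖² + φ x ⟨F (m x • x), x⟩ = 0`, with first term positive and second
    -- nonnegative.
    nlinarith [mul_nonneg hφ0 hin, mul_pos (sub_pos.mpr hφ1) (pow_pos hx0 2)]

/-! ### Comparison of `p` with the Euclidean norm -/

theorem Seminorm.continuous_of_finiteDimensional (p : Seminorm ℝ E) : Continuous p :=
  continuousOn_univ.mp (p.convexOn.continuousOn isOpen_univ)

/-- By compactness `p` has a positive minimum on the unit sphere; homogeneity does the rest. -/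
theorem Seminorm.IsNorm.exists_norm_le_mul {p : Seminorm ℝ E} (hp : p.IsNorm) :
    ∃ C > 0, ∀ x, ‖x‖ ≤ C * p x := by
  have hpc := p.continuous_of_finiteDimensional
  rcases subsingleton_or_nontrivial E with hE | hE
  · exact ⟨1, one_pos, fun x => by simp [Subsingleton.elim x 0]⟩
  obtain ⟨u, hu, hmin⟩ := (isCompact_sphere (0 : E) 1).exists_isMinOn
    (NormedSpace.sphere_nonempty.mpr zero_le_one) hpc.continuousOn
  have hu0 : 0 < p u := (apply_nonneg p u).lt_of_ne' fun h => by
    simp [hp u h] at hu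
  refine ⟨(p u)⁻¹, inv_pos.mpr hu0, fun x => ?_⟩
  rcases eq_or_ne x 0 with rfl | hx
  · simp
  have hx' : 0 < ‖x‖ := norm_pos_iff.mpr hx
  have h1 : p u ≤ p (‖x‖⁻¹ • x) := hmin (by simp [norm_smul, hx'.ne'])
  rw [map_smul_eq_mul, norm_inv, norm_norm, inv_mul_eq_div, le_div_iff₀ hx'] at h1
  rw [inv_mul_eq_div, le_div_iff₀ hu0, mul_comm]
  exact h1

theorem Seminorm.ContinuousSelfMap.continuous {p : Seminorm ℝ E} (hp : p.IsNorm) {F : E → E}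
    (hF : p.ContinuousSelfMap F) : Continuous F := by
  obtain ⟨C, hC, hle⟩ := hp.exists_norm_le_mul
  have hpc := p.continuous_of_finiteDimensional
  rw [continuous_iff_continuousAt]
  intro x
  rw [Metric.continuousAt_iff']
  intro ε hε
  obtain ⟨δ, hδ, h⟩ := hF x (ε / C) (by positivity)
  have : ∀ᶠ y in 𝓝 x, p (y - x) < δ :=
    (hpc.comp (continuous_id.sub continuous_const)).continuousAt.eventually_lt_const (by simpa)
  filter_upwards [this] with y hy
  rw [dist_eq_norm]
  calc ‖F y - F x‖ ≤ C * p (F y - F x) := hle _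
    _ < C * (ε / C) := by gcongr; exact h y hy
    _ = ε := mul_div_cancel₀ _ hC.ne'

theorem mainTheorem7 (d : ℕ)
    (p : Seminorm ℝ (EuclideanSpace ℝ (Fin d))) (hp : p.IsNorm)
    (F : EuclideanSpace ℝ (Fin d) → EuclideanSpace ℝ (Fin d)) (hF : p.ContinuousSelfMap F)
    (ϱ : ℝ) (hϱ : 0 < ϱ)
    (h : ∀ ξ : EuclideanSpace ℝ (Fin d), p ξ = ϱ → 0 ≤ inner ℝ (F ξ) ξ) :
    ∃ z₀ : EuclideanSpace ℝ (Fin d), p z₀ ≤ ϱ ∧ F z₀ = 0 := by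
  obtain ⟨C, hC0, hC⟩ := hp.exists_norm_le_mul
  exact exists_zero_of_inner_nonneg p.continuous_of_finiteDimensional hC0 hC
    (hF.continuous hp) hϱ h
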